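/- Let $n\ge 0$ and let $\lambda\vdash n$ be a Young diagram with $n$ boxes, where a box $b=(i,j)$ lies in row $i$ and column $j$ (English convention). The content of $b=(i,j)$ is $c(b)=j-i$. For a Young diagram $\nu$ and a box $b=(i,j)\in\nu$, the hook length $h_\nu(b)$ is the number of boxes $(i',j')\in\nu$ with either $i'=i$ and $j'\ge j$, or $j'=j$ and $i'\ge i$. Let $b^{(0)},\dots,b^{(s)}$ be the addable boxes of $\lambda$, that is, the boxes $b\notin\lambda$ such that $\lambda\cup\{b\}$ is again a Young diagram, and put $\lambda^{(j)}=\lambda\cup\{b^{(j)}\}$. Then $$\sum_{j=0}^{s} c(b^{(j)})\,\frac{\prod_{b\in\lambda}h_\lambda(b)}{\prod_{b\in\lambda^{(j)}}h_{\lambda^{(j)}}(b)}=0 \qquad\text{and}\qquad \sum_{j=0}^{s} c(b^{(j)})^2\,\frac{\prod_{b\in\lambda}h_\lambda(b)}{\prod_{b\in\lambda^{(j)}}h_{\lambda^{(j)}}(b)}=n.$$ -/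

import Mathlib

namespace YoungDiagram

/-- The hook length of the box `b = (i, j)` in `μ`: the number of boxes `(i', j')` of `μ` with
`i' = i`, `j' ≥ j` or `j' = j`, `i' ≥ i`. -/
def hookLength (μ : YoungDiagram) (b : ℕ × ℕ) : ℕ :=
  (μ.cells.filter fun b' => (b'.1 = b.1 ∧ b.2 ≤ b'.2) ∨ (b'.2 = b.2 ∧ b.1 ≤ b'.1)).card

/-- The content (column index minus row index) of a box. Mathlib's boxes are indexed from `0`
in both coordinates, which does not affect the difference. -/
def boxContent (b : ℕ × ℕ) : ℤ := (b.2 : ℤ) - (b.1 : ℤ)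

/-- A box outside `μ` is addable if `μ` together with this box is again a Young diagram. -/
def IsAddable (μ : YoungDiagram) (b : ℕ × ℕ) : Prop :=
  b ∉ μ ∧ IsLowerSet ((insert b μ.cells : Finset (ℕ × ℕ)) : Set (ℕ × ℕ))

/-- The type of addable boxes of `μ`. -/
abbrev AddableBox (μ : YoungDiagram) : Type := {b : ℕ × ℕ // μ.IsAddable b}

/-- The Young diagram obtained from `μ` by adding an addable box. -/
def addBox (μ : YoungDiagram) (b : μ.AddableBox) : YoungDiagram where
  cells := insert b.1 μ.cells
  isLowerSet := b.2.2

theorem finite_setOf_isAddable (μ : YoungDiagram) : {b | μ.IsAddable b}.Finite := by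
  refine Set.Finite.subset (insert ((0, 0) : ℕ × ℕ)
    (μ.cells.image (fun c => (c.1 + 1, c.2)) ∪
      μ.cells.image (fun c => (c.1, c.2 + 1)))).finite_toSet ?_
  rintro ⟨i, j⟩ ⟨-, hl⟩
  have key : ∀ c : ℕ × ℕ, c ≤ (i, j) → c ≠ (i, j) → c ∈ μ.cells := by
    intro c hc hne
    have h := hl hc (Finset.mem_coe.2 (Finset.mem_insert_self (i, j) μ.cells))
    exact (Finset.mem_insert.1 (Finset.mem_coe.1 h)).resolve_left hne
  rw [Finset.mem_coe, Finset.mem_insert, Finset.mem_union, Finset.mem_image, Finset.mem_image]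
  rcases i with _ | i
  · rcases j with _ | j
    · exact Or.inl rfl
    · exact Or.inr (Or.inr ⟨(0, j), key _ (by simp) (by simp), rfl⟩)
  · exact Or.inr (Or.inl ⟨(i, j), key _ (by simp) (by simp), rfl⟩)

noncomputable instance (μ : YoungDiagram) : Fintype μ.AddableBox :=
  μ.finite_setOf_isAddable.fintype

end YoungDiagram

/-! Take m at least the number of rows and put y_i = λ_i - i for i ≤ m, so y_m = -m. An addable box
in row i has content y_i. Expressing hook products by factorials and the Vandermonde product of the
y_i (`prod_hookLength_mul_diffProd`) turns the ratio for row i into ∏_{j<m}(y_i + 1 - y_j) /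
∏_{j≠i}(y_i - y_j), which vanishes on rows without an addable box. The k-th moment is therefore the
divided difference at y_0, …, y_m of X^k ∏_{j<m}(X - (y_j - 1)). Divided differences kill degree
below m and send X^(m+r) to the complete symmetric polynomial h_r(y). With e_r taken at the y_j - 1,
the moments are h_1 - e_1 and h_2 - e_1 h_1 + e_2, which y_m = -m reduces to 0 and ∑_{j<m}(y_j + j)
= n. -/

/-! ### Divided differences and expansions of products of linear factors -/

open Polynomial in
/-- The divided difference of a polynomial at the nodes `y 0, …, y m`. -/
noncomputable def dividedDifference (m : ℕ) (y : ℕ → ℚ) : ℚ[X] →ₗ[ℚ] ℚ :=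
  ∑ i ∈ Finset.range (m + 1),
    (∏ j ∈ (Finset.range (m + 1)).erase i, (y i - y j))⁻¹ • Polynomial.leval (y i)

open Polynomial in
theorem dividedDifference_apply (m : ℕ) (y : ℕ → ℚ) (f : ℚ[X]) :
    dividedDifference m y f = ∑ i ∈ Finset.range (m + 1),
      f.eval (y i) / ∏ j ∈ (Finset.range (m + 1)).erase i, (y i - y j) := by
  simp [dividedDifference, LinearMap.sum_apply, div_eq_inv_mul]

-- Lagrange interpolation at the m + 1 nodes recovers f, and each basis polynomial has leading
-- coefficient the inverse of its node product.
open Polynomial in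
theorem dividedDifference_eq_coeff {m : ℕ} {y : ℕ → ℚ}
    (hy : Set.InjOn y (Finset.range (m + 1))) {f : ℚ[X]} (hf : f.degree < (m + 1 : ℕ)) :
    dividedDifference m y f = f.coeff m := by
  have h := Lagrange.coeff_eq_sum hy (P := f) (by simpa using hf)
  rw [dividedDifference_apply, ← h]
  simp

open Polynomial in
theorem dividedDifference_mul_prod (m : ℕ) (y : ℕ → ℚ) (f : ℚ[X]) :
    dividedDifference m y (f * ∏ j ∈ Finset.range (m + 1), (X - C (y j))) = 0 := by
  rw [dividedDifference_apply]
  refine Finset.sum_eq_zero fun i hi => ?_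
  rw [eval_mul, eval_prod, Finset.prod_eq_zero hi (by simp)]
  simp

open Polynomial in
theorem degree_X_sub_C_mul_lt {R : ℚ[X]} {n : ℕ} (hR : R.degree < n) (a : ℚ) :
    ((X - C a) * R).degree < ((n + 1 : ℕ) : WithBot ℕ) := by
  rcases eq_or_ne R 0 with rfl | h
  · rw [mul_zero, degree_zero]
    exact WithBot.bot_lt_coe (n + 1)
  · rw [degree_mul, degree_X_sub_C, degree_eq_natDegree h] at *
    norm_cast at *
    omega

open Polynomial in
theorem prod_X_sub_C_eq_add (a : ℕ → ℚ) (n : ℕ) :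
    ∃ R : ℚ[X], R.degree < n ∧ ∏ j ∈ Finset.range n, (X - C (a j)) = X ^ n + R := by
  induction n with
  | zero => exact ⟨0, by simp, by simp⟩
  | succ n ih =>
    obtain ⟨R, hR, h⟩ := ih
    refine ⟨(X - C (a n)) * R - C (a n) * X ^ n, ?_, ?_⟩
    · refine (degree_sub_le _ _).trans_lt (max_lt (degree_X_sub_C_mul_lt hR _) ?_)
      exact (degree_C_mul_X_pow_le _ _).trans_lt (by exact_mod_cast n.lt_succ_self)
    · rw [Finset.prod_range_succ, h]
      ring

open Polynomial in
theorem X_mul_prod_X_sub_C_eq_add (a : ℕ → ℚ) (n : ℕ) :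
    ∃ R : ℚ[X], R.degree < n ∧ X * ∏ j ∈ Finset.range n, (X - C (a j)) =
      X ^ (n + 1) - C (∑ j ∈ Finset.range n, a j) * X ^ n + R := by
  induction n with
  | zero => exact ⟨0, by simp, by simp⟩
  | succ n ih =>
    obtain ⟨R, hR, h⟩ := ih
    refine ⟨(X - C (a n)) * R + C (a n * ∑ j ∈ Finset.range n, a j) * X ^ n, ?_, ?_⟩
    · refine (degree_add_le _ _).trans_lt (max_lt (degree_X_sub_C_mul_lt hR _) ?_)
      exact (degree_C_mul_X_pow_le _ _).trans_lt (by exact_mod_cast n.lt_succ_self)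
    · rw [Finset.prod_range_succ, ← mul_assoc, h, Finset.sum_range_succ]
      simp only [C_add, C_mul]
      ring

open Polynomial in
theorem X_sq_mul_prod_X_sub_C_eq_add (a : ℕ → ℚ) (n : ℕ) :
    ∃ R : ℚ[X], R.degree < n ∧ X ^ 2 * ∏ j ∈ Finset.range n, (X - C (a j)) =
      X ^ (n + 2) - C (∑ j ∈ Finset.range n, a j) * X ^ (n + 1) +
        C (((∑ j ∈ Finset.range n, a j) ^ 2 - ∑ j ∈ Finset.range n, a j ^ 2) / 2) * X ^ n + R := by
  induction n with
  | zero => exact ⟨0, by simp, by simp⟩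
  | succ n ih =>
    obtain ⟨R, hR, h⟩ := ih
    refine ⟨(X - C (a n)) * R - C (a n * (((∑ j ∈ Finset.range n, a j) ^ 2 -
      ∑ j ∈ Finset.range n, a j ^ 2) / 2)) * X ^ n, ?_, ?_⟩
    · refine (degree_sub_le _ _).trans_lt (max_lt (degree_X_sub_C_mul_lt hR _) ?_)
      exact (degree_C_mul_X_pow_le _ _).trans_lt (by exact_mod_cast n.lt_succ_self)
    · rw [Finset.prod_range_succ, ← mul_assoc, h, Finset.sum_range_succ, Finset.sum_range_succ,
        show ((∑ j ∈ Finset.range n, a j + a n) ^ 2 -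
          (∑ j ∈ Finset.range n, a j ^ 2 + a n ^ 2)) / 2 =
          ((∑ j ∈ Finset.range n, a j) ^ 2 - ∑ j ∈ Finset.range n, a j ^ 2) / 2 +
            a n * ∑ j ∈ Finset.range n, a j by ring]
      simp only [C_add, C_mul]
      ring

/-! ### Moments of the transition weights -/

section Moments

variable {m : ℕ} {y : ℕ → ℚ}

open Polynomial in
theorem dividedDifference_eq_zero_of_degree_lt (hy : Set.InjOn y (Finset.range (m + 1)))
    {R : ℚ[X]} (hR : R.degree < m) : dividedDifference m y R = 0 := by
  rw [dividedDifference_eq_coeff hy (hR.trans (by exact_mod_cast m.lt_succ_self))]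
  exact coeff_eq_zero_of_degree_lt hR

open Polynomial in
theorem dividedDifference_C_mul (a : ℚ) (f : ℚ[X]) :
    dividedDifference m y (C a * f) = a * dividedDifference m y f := by
  rw [← smul_eq_C_mul, map_smul, smul_eq_mul]

open Polynomial in
theorem dividedDifference_X_pow (hy : Set.InjOn y (Finset.range (m + 1))) :
    dividedDifference m y (X ^ m) = 1 := by
  rw [dividedDifference_eq_coeff hy]
  · simp
  · rw [degree_X_pow]
    exact_mod_cast m.lt_succ_self

open Polynomial in
theorem dividedDifference_X_pow_succ (hy : Set.InjOn y (Finset.range (m + 1))) :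
    dividedDifference m y (X ^ (m + 1)) = ∑ j ∈ Finset.range (m + 1), y j := by
  obtain ⟨R, hR, h⟩ := X_mul_prod_X_sub_C_eq_add y m
  obtain ⟨S, hS, h'⟩ := prod_X_sub_C_eq_add y m
  -- Expanding the vanishing node polynomial gives a linear relation that determines the next power.
  have key := dividedDifference_mul_prod m y 1
  rw [one_mul, Finset.prod_range_succ, mul_comm, sub_mul, h, h'] at key
  simp only [map_sub, map_add, dividedDifference_C_mul, dividedDifference_X_pow hy,
    dividedDifference_eq_zero_of_degree_lt hy hR, dividedDifference_eq_zero_of_degree_lt hy hS]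
    at key
  rw [Finset.sum_range_succ]
  linarith

open Polynomial in
theorem dividedDifference_X_pow_add_two (hy : Set.InjOn y (Finset.range (m + 1))) :
    dividedDifference m y (X ^ (m + 2)) =
      ((∑ j ∈ Finset.range (m + 1), y j) ^ 2 + ∑ j ∈ Finset.range (m + 1), y j ^ 2) / 2 := by
  obtain ⟨R, hR, h⟩ := X_sq_mul_prod_X_sub_C_eq_add y m
  obtain ⟨S, hS, h'⟩ := X_mul_prod_X_sub_C_eq_add y m
  have key := dividedDifference_mul_prod m y X
  rw [Finset.prod_range_succ, show ∀ p : ℚ[X], X * (p * (X - C (y m))) =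
    X ^ 2 * p - C (y m) * (X * p) from fun p => by ring, h, h'] at key
  simp only [map_sub, map_add, dividedDifference_C_mul, dividedDifference_X_pow hy,
    dividedDifference_X_pow_succ hy,
    dividedDifference_eq_zero_of_degree_lt hy hR, dividedDifference_eq_zero_of_degree_lt hy hS]
    at key
  rw [Finset.sum_range_succ] at key ⊢
  rw [Finset.sum_range_succ]
  linear_combination key

/-- The transition weight of row `i` for the shifted row lengths `y 0, …, y m`. -/
def transitionWeight (m : ℕ) (y : ℕ → ℚ) (i : ℕ) : ℚ :=
  (∏ j ∈ Finset.range m, (y i + 1 - y j)) / ∏ j ∈ (Finset.range (m + 1)).erase i, (y i - y j)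

open Polynomial in
theorem sum_pow_mul_transitionWeight (k : ℕ) :
    ∑ i ∈ Finset.range (m + 1), y i ^ k * transitionWeight m y i =
      dividedDifference m y (X ^ k * ∏ j ∈ Finset.range m, (X - C (y j - 1))) := by
  rw [dividedDifference_apply]
  refine Finset.sum_congr rfl fun i _ => ?_
  rw [transitionWeight, eval_mul, eval_prod, mul_div_assoc]
  simp [sub_add_eq_add_sub, ← sub_add]

theorem sum_mul_transitionWeight (hy : Set.InjOn y (Finset.range (m + 1))) (hm : y m = -m) :
    ∑ i ∈ Finset.range (m + 1), y i * transitionWeight m y i = 0 := by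
  have h1 := sum_pow_mul_transitionWeight (m := m) (y := y) 1
  obtain ⟨R, hR, h⟩ := X_mul_prod_X_sub_C_eq_add (fun j => y j - 1) m
  simp only [pow_one] at h1
  rw [h1, h]
  simp only [map_sub, map_add, dividedDifference_C_mul, dividedDifference_X_pow hy,
    dividedDifference_X_pow_succ hy, dividedDifference_eq_zero_of_degree_lt hy hR]
  simp [Finset.sum_range_succ, hm]

theorem sum_sq_mul_transitionWeight (hy : Set.InjOn y (Finset.range (m + 1))) (hm : y m = -m) :
    ∑ i ∈ Finset.range (m + 1), y i ^ 2 * transitionWeight m y i =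
      ∑ j ∈ Finset.range m, (y j + j) := by
  obtain ⟨R, hR, h⟩ := X_sq_mul_prod_X_sub_C_eq_add (fun j => y j - 1) m
  rw [sum_pow_mul_transitionWeight, h]
  simp only [map_sub, map_add, dividedDifference_C_mul, dividedDifference_X_pow hy,
    dividedDifference_X_pow_succ hy, dividedDifference_X_pow_add_two hy,
    dividedDifference_eq_zero_of_degree_lt hy hR]
  have hid : ∀ n : ℕ, ∑ j ∈ Finset.range n, (j : ℚ) = (n : ℚ) * (n - 1) / 2 := fun n => by
    induction n with
    | zero => simp
    | succ n ih => rw [Finset.sum_range_succ, ih]; push_cast; ring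
  -- Here h_1(y) and e_1(y - 1) coincide, so their squares cancel and only linear terms survive.
  simp only [Finset.sum_range_succ, hm, sub_sq, Finset.sum_add_distrib, Finset.sum_sub_distrib,
    ← Finset.sum_mul, ← Finset.mul_sum, Finset.sum_const, Finset.card_range, hid]
  simp
  ring

end Moments
-- Vandermonde product under change of one entry
/-- The product of the differences `f a - f b` over all `a < b < N`. -/
def diffProd (N : ℕ) (f : ℕ → ℚ) : ℚ :=
  ∏ b ∈ Finset.range N, ∏ a ∈ Finset.range b, (f a - f b)

/-- Only factors involving i change, and their orientation signs agree on both sides.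
Cross-multiplication avoids any nonvanishing hypothesis. -/
theorem diffProd_mul_prod_erase {f g : ℕ → ℚ} {i : ℕ} (h : ∀ j, j ≠ i → g j = f j) {N : ℕ}
    (hi : i < N) :
    diffProd N g * ∏ j ∈ (Finset.range N).erase i, (f i - f j) =
      diffProd N f * ∏ j ∈ (Finset.range N).erase i, (g i - f j) := by
  induction N with
  | zero => omega
  | succ N ih =>
    rw [diffProd, diffProd, Finset.prod_range_succ, Finset.prod_range_succ, ← diffProd, ← diffProd]
    rcases Nat.lt_succ_iff_lt_or_eq.1 hi with hlt | rfl
    · have hne : N ≠ i := hlt.ne'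
      have hmem : N ∉ (Finset.range N).erase i := by simp
      have hi' : i ∈ Finset.range N := Finset.mem_range.2 hlt
      rw [Finset.range_add_one, Finset.erase_insert_of_ne hne, Finset.prod_insert hmem,
        Finset.prod_insert hmem, ← Finset.mul_prod_erase _ (fun a => g a - g N) hi',
        ← Finset.mul_prod_erase _ (fun a => f a - f N) hi', h N hne,
        Finset.prod_congr rfl (fun a ha => by rw [h a (Finset.ne_of_mem_erase ha)] :
          ∀ a ∈ (Finset.range N).erase i, g a - f N = f a - f N)]
      linear_combination (g i - f N) * (f i - f N) *
        (∏ a ∈ (Finset.range N).erase i, (f a - f N)) * ih hlt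
    · have hgf : diffProd i g = diffProd i f := by
        refine Finset.prod_congr rfl fun b hb => Finset.prod_congr rfl fun a ha => ?_
        simp only [Finset.mem_range] at ha hb
        rw [h a (by omega), h b (by omega)]
      have hneg : ∀ c : ℚ, ∏ a ∈ Finset.range i, (f a - c) =
          (-1) ^ i * ∏ a ∈ Finset.range i, (c - f a) := fun c => by
        rw [← Finset.card_range i, ← Finset.prod_const, Finset.card_range,
          ← Finset.prod_mul_distrib]
        exact Finset.prod_congr rfl fun a _ => by ring
      rw [Finset.range_add_one, Finset.erase_insert (by simp), hgf, hneg,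
        Finset.prod_congr rfl (fun a ha => by rw [h a (Finset.mem_range.1 ha).ne] :
          ∀ a ∈ Finset.range i, g a - g i = f a - g i), hneg]
      ring

/-! ### Hook products in terms of row lengths -/

namespace YoungDiagram

theorem hookLength_add {μ : YoungDiagram} {i j : ℕ} (h : (i, j) ∈ μ) :
    μ.hookLength (i, j) + (i + j + 1) = μ.rowLen i + μ.colLen j := by
  have hset : (μ.cells.filter fun b' => (b'.1 = (i, j).1 ∧ (i, j).2 ≤ b'.2) ∨
      (b'.2 = (i, j).2 ∧ (i, j).1 ≤ b'.1)) =
      ({i} ×ˢ Finset.Ico j (μ.rowLen i)) ∪ (Finset.Ioo i (μ.colLen j) ×ˢ {j}) := by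
    ext ⟨a, b⟩
    simp only [Finset.mem_filter, mem_cells, Finset.mem_union, Finset.mem_product,
      Finset.mem_singleton, Finset.mem_Ico, Finset.mem_Ioo]
    constructor
    · rintro ⟨hm, ⟨rfl, hb⟩ | ⟨rfl, ha⟩⟩
      · exact Or.inl ⟨rfl, hb, mem_iff_lt_rowLen.1 hm⟩
      · rcases ha.eq_or_lt with rfl | hlt
        · exact Or.inl ⟨rfl, le_rfl, mem_iff_lt_rowLen.1 hm⟩
        · exact Or.inr ⟨⟨hlt, mem_iff_lt_colLen.1 hm⟩, rfl⟩
    · rintro (⟨rfl, hb, hlt⟩ | ⟨⟨ha, hlt⟩, rfl⟩)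
      · exact ⟨mem_iff_lt_rowLen.2 hlt, Or.inl ⟨rfl, hb⟩⟩
      · exact ⟨mem_iff_lt_colLen.2 hlt, Or.inr ⟨rfl, ha.le⟩⟩
  have hdisj : Disjoint (({i} : Finset ℕ) ×ˢ Finset.Ico j (μ.rowLen i))
      (Finset.Ioo i (μ.colLen j) ×ˢ {j}) := by
    rw [Finset.disjoint_left]
    rintro ⟨a, b⟩ h1 h2
    simp only [Finset.mem_product, Finset.mem_singleton, Finset.mem_Ioo] at h1 h2
    omega
  rw [hookLength, hset, Finset.card_union_of_disjoint hdisj]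
  simp only [Finset.card_product, Finset.card_singleton, Nat.card_Ico, Nat.card_Ioo]
  have h1 := mem_iff_lt_rowLen.1 h
  have h2 := mem_iff_lt_colLen.1 h
  omega

/-- The row lengths of `μ`, shifted to the contents of the first boxes to the right of the rows. -/
def rowContent (μ : YoungDiagram) (i : ℕ) : ℚ := (μ.rowLen i : ℚ) - i

theorem rowContent_strictAnti (μ : YoungDiagram) : StrictAnti μ.rowContent := by
  intro a b hab
  have h : (μ.rowLen b : ℚ) ≤ μ.rowLen a := by exact_mod_cast μ.rowLen_anti a b hab.le
  have h' : (a : ℚ) < b := by exact_mod_cast hab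
  simp only [rowContent]
  linarith

theorem rowContent_eq_neg (μ : YoungDiagram) {m : ℕ} (hm : μ.colLen 0 ≤ m) :
    μ.rowContent m = -m := by
  have : μ.rowLen m = 0 := by
    by_contra h
    have := mem_iff_lt_colLen.1 (mem_iff_lt_rowLen.2 (Nat.pos_of_ne_zero h))
    omega
  simp [rowContent, this]

/-- The hook lengths in row i and the differences y_i - y_b for i < b ≤ m together are exactly 1, …,
λ_i + m - i, each once. The natural subtraction is exact since λ_b ≤ λ_i and i < b. -/
theorem prod_hookLength_row_mul (μ : YoungDiagram) {m i : ℕ} (hm : μ.colLen 0 ≤ m + 1)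
    (hi : i < m + 1) :
    (∏ c ∈ Finset.range (μ.rowLen i), μ.hookLength (i, c)) *
      ∏ b ∈ Finset.Ioo i (m + 1), (μ.rowLen i + b - (μ.rowLen b + i)) =
        Nat.factorial (μ.rowLen i + (m - i)) := by
  have hook : ∀ c < μ.rowLen i, μ.hookLength (i, c) + (i + c + 1) = μ.rowLen i + μ.colLen c ∧
      i < μ.colLen c ∧ μ.colLen c ≤ m + 1 := fun c hc =>
    ⟨hookLength_add (mem_iff_lt_rowLen.2 hc), mem_iff_lt_colLen.1 (mem_iff_lt_rowLen.2 hc),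
      (μ.colLen_anti 0 c c.zero_le).trans hm⟩
  have hinj1 : Set.InjOn (fun c => μ.hookLength (i, c)) (Finset.range (μ.rowLen i)) := by
    intro c hc d hd hcd
    simp only [Finset.coe_range, Set.mem_Iio] at hc hd hcd
    have h1 := hook c hc
    have h2 := hook d hd
    rcases lt_trichotomy c d with h | h | h
    · have := μ.colLen_anti c d h.le
      omega
    · exact h
    · have := μ.colLen_anti d c h.le
      omega
  have hinj2 : Set.InjOn (fun b => μ.rowLen i + b - (μ.rowLen b + i)) (Finset.Ioo i (m + 1)) := by
    intro c hc d hd hcd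
    simp only [Finset.coe_Ioo, Set.mem_Ioo] at hc hd hcd
    have h1 := μ.rowLen_anti i c hc.1.le
    have h2 := μ.rowLen_anti i d hd.1.le
    rcases lt_trichotomy c d with h | h | h
    · have := μ.rowLen_anti c d h.le
      omega
    · exact h
    · have := μ.rowLen_anti d c h.le
      omega
  have hdisj : Disjoint ((Finset.range (μ.rowLen i)).image fun c => μ.hookLength (i, c))
      ((Finset.Ioo i (m + 1)).image fun b => μ.rowLen i + b - (μ.rowLen b + i)) := by
    simp only [Finset.disjoint_left, Finset.mem_image, Finset.mem_range, Finset.mem_Ioo]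
    rintro _ ⟨c, hc, rfl⟩ ⟨b, hb, hbc⟩
    have h1 := hook c hc
    have h2 := μ.rowLen_anti i b hb.1.le
    -- A coincidence would force λ_b + λ'_c = b + c + 1, but the sum is at least b + c + 2 if (b, c)
    -- is in the diagram and at most b + c otherwise.
    have h3 : c < μ.rowLen b ↔ b < μ.colLen c := mem_iff_lt_rowLen.symm.trans mem_iff_lt_colLen
    by_cases h : c < μ.rowLen b
    · have := h3.1 h
      omega
    · have := mt h3.2 h
      omega
  have hunion : ((Finset.range (μ.rowLen i)).image fun c => μ.hookLength (i, c)) ∪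
      ((Finset.Ioo i (m + 1)).image fun b => μ.rowLen i + b - (μ.rowLen b + i)) =
      Finset.Icc 1 (μ.rowLen i + (m - i)) := by
    refine Finset.eq_of_subset_of_card_le ?_ ?_
    · intro x
      simp only [Finset.mem_union, Finset.mem_image, Finset.mem_range, Finset.mem_Ioo,
        Finset.mem_Icc]
      rintro (⟨c, hc, rfl⟩ | ⟨b, hb, rfl⟩)
      · have := hook c hc
        omega
      · have := μ.rowLen_anti i b hb.1.le
        omega
    · rw [Finset.card_union_of_disjoint hdisj, Finset.card_image_of_injOn hinj1,
        Finset.card_image_of_injOn hinj2]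
      simp only [Nat.card_Icc, Finset.card_range, Nat.card_Ioo]
      omega
  rw [← Finset.prod_Ico_id_eq_factorial, Finset.Ico_add_one_right_eq_Icc, ← hunion, Finset.prod_union hdisj,
    Finset.prod_image hinj1, Finset.prod_image hinj2]

theorem mem_cells_iff_of_colLen_le (μ : YoungDiagram) {N : ℕ} (hN : μ.colLen 0 ≤ N) (p : ℕ × ℕ) :
    p ∈ μ.cells ↔ p.1 ∈ Finset.range N ∧ p.2 ∈ Finset.range (μ.rowLen p.1) := by
  rw [mem_cells, Finset.mem_range, Finset.mem_range, ← mem_iff_lt_rowLen]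
  refine ⟨fun h => ⟨?_, h⟩, fun h => h.2⟩
  have := mem_iff_lt_colLen.1 (μ.up_left_mem le_rfl p.2.zero_le h)
  omega

/-- The product of all hook lengths in terms of the row lengths. -/
theorem prod_hookLength_mul_diffProd (μ : YoungDiagram) {m : ℕ} (hm : μ.colLen 0 ≤ m + 1) :
    (∏ x ∈ μ.cells, (μ.hookLength x : ℚ)) * diffProd (m + 1) μ.rowContent =
      ∏ i ∈ Finset.range (m + 1), (Nat.factorial (μ.rowLen i + (m - i)) : ℚ) := by
  have hV : diffProd (m + 1) μ.rowContent = ∏ a ∈ Finset.range (m + 1),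
      ∏ b ∈ Finset.Ioo a (m + 1), (μ.rowContent a - μ.rowContent b) := by
    refine Finset.prod_comm' fun x y => ?_
    simp only [Finset.mem_range, Finset.mem_Ioo]
    omega
  rw [hV, Finset.prod_finset_product _ _ (fun i => Finset.range (μ.rowLen i))
    (μ.mem_cells_iff_of_colLen_le hm),
    ← Finset.prod_mul_distrib]
  refine Finset.prod_congr rfl fun i hi => ?_
  rw [← μ.prod_hookLength_row_mul hm (Finset.mem_range.1 hi)]
  push_cast
  congr 1
  refine Finset.prod_congr rfl fun b hb => ?_
  have hb := Finset.mem_Ioo.1 hb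
  have := μ.rowLen_anti i b hb.1.le
  rw [Nat.cast_sub (by omega), rowContent, rowContent]
  push_cast
  ring

/-! ### Addable boxes -/

theorem IsAddable.snd_eq {μ : YoungDiagram} {b : ℕ × ℕ} (hb : μ.IsAddable b) :
    b.2 = μ.rowLen b.1 := by
  obtain ⟨i, j⟩ := b
  refine le_antisymm ?_ (not_lt.1 fun h => hb.1 (mem_iff_lt_rowLen.2 h))
  by_contra! h
  have h1 : (i, μ.rowLen i) ∈ insert (i, j) μ.cells :=
    hb.2 (show (i, μ.rowLen i) ≤ (i, j) from ⟨le_rfl, h.le⟩)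
      (Finset.mem_coe.2 (Finset.mem_insert_self _ _))
  rcases Finset.mem_insert.1 h1 with h2 | h2
  · exact h.ne (Prod.ext_iff.1 h2).2
  · exact (mem_iff_lt_rowLen.1 h2).false

theorem IsAddable.fst_le {μ : YoungDiagram} {b : ℕ × ℕ} (hb : μ.IsAddable b) :
    b.1 ≤ μ.colLen 0 := by
  obtain ⟨i, j⟩ := b
  by_contra! h
  have h1 : (μ.colLen 0, 0) ∈ insert (i, j) μ.cells :=
    hb.2 (show (μ.colLen 0, 0) ≤ (i, j) from ⟨h.le, j.zero_le⟩)
      (Finset.mem_coe.2 (Finset.mem_insert_self _ _))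
  rcases Finset.mem_insert.1 h1 with h2 | h2
  · exact h.ne (Prod.ext_iff.1 h2).1
  · exact (mem_iff_lt_colLen.1 h2).false

theorem mem_addBox {μ : YoungDiagram} {b : μ.AddableBox} {x : ℕ × ℕ} :
    x ∈ μ.addBox b ↔ x = b.1 ∨ x ∈ μ := by
  rw [← mem_cells, ← mem_cells]
  exact Finset.mem_insert

theorem rowLen_addBox (μ : YoungDiagram) (b : μ.AddableBox) (i : ℕ) :
    (μ.addBox b).rowLen i = μ.rowLen i + if i = b.1.1 then 1 else 0 := by
  refine eq_of_forall_lt_iff fun c => ?_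
  rw [← mem_iff_lt_rowLen, mem_addBox, mem_iff_lt_rowLen, Prod.ext_iff, b.2.snd_eq]
  dsimp only
  split_ifs with h
  · subst h
    omega
  · omega

theorem colLen_addBox_le (μ : YoungDiagram) (b : μ.AddableBox) {m : ℕ} (hm : μ.colLen 0 ≤ m) :
    (μ.addBox b).colLen 0 ≤ m + 1 := by
  by_contra! h
  rcases mem_addBox.1 (mem_iff_lt_colLen.2 h) with h | h
  · have := b.2.fst_le
    rw [← h] at this
    dsimp only at this
    omega
  · have := mem_iff_lt_colLen.1 h
    omega

theorem isAddable_of_rowLen_lt {μ : YoungDiagram} {i : ℕ}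
    (h : i = 0 ∨ μ.rowLen i < μ.rowLen (i - 1)) : μ.IsAddable (i, μ.rowLen i) := by
  refine ⟨fun hm => (mem_iff_lt_rowLen.1 hm).false, ?_⟩
  rintro x ⟨c, d⟩ hle hx
  simp only [Finset.coe_insert, Set.mem_insert_iff, Finset.mem_coe, mem_cells] at hx ⊢
  rcases hx with rfl | hx
  · obtain ⟨hc, hd⟩ := Prod.mk_le_mk.1 hle
    rcases hc.eq_or_lt with rfl | hc
    · rcases hd.eq_or_lt with rfl | hd
      · exact Or.inl rfl
      · exact Or.inr (mem_iff_lt_rowLen.2 hd)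
    · refine Or.inr (mem_iff_lt_rowLen.2 ?_)
      have := μ.rowLen_anti c (i - 1) (by omega)
      omega
  · exact Or.inr (μ.isLowerSet hle hx)

theorem prod_hookLength_ne_zero (μ : YoungDiagram) :
    ∏ x ∈ μ.cells, (μ.hookLength x : ℚ) ≠ 0 := by
  refine Finset.prod_ne_zero_iff.2 fun x hx => ?_
  have : x ∈ μ.cells.filter fun b' => (b'.1 = x.1 ∧ x.2 ≤ b'.2) ∨ (b'.2 = x.2 ∧ x.1 ≤ b'.1) :=
    Finset.mem_filter.2 ⟨hx, Or.inl ⟨rfl, le_rfl⟩⟩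
  exact_mod_cast (Finset.card_pos.2 ⟨x, this⟩).ne'

/-! ### Hook ratios as transition weights -/

theorem hookLength_ratio_eq_transitionWeight (μ : YoungDiagram) (b : μ.AddableBox) {m : ℕ}
    (hm : μ.colLen 0 ≤ m) :
    (∏ x ∈ μ.cells, (μ.hookLength x : ℚ)) /
      ∏ x ∈ (μ.addBox b).cells, ((μ.addBox b).hookLength x : ℚ) =
        transitionWeight m μ.rowContent b.1.1 := by
  set i := b.1.1 with hi
  have him : i < m + 1 := Nat.lt_succ_of_le (b.2.fst_le.trans hm)
  have hmem : i ∈ Finset.range (m + 1) := Finset.mem_range.2 him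
  have hH := μ.prod_hookLength_mul_diffProd (hm.trans m.le_succ)
  have hH' := (μ.addBox b).prod_hookLength_mul_diffProd (μ.colLen_addBox_le b hm)
  have hoff : ∀ j, j ≠ i → (μ.addBox b).rowContent j = μ.rowContent j := fun j hj => by
    simp [rowContent, rowLen_addBox, hj, ← hi]
  have hon : (μ.addBox b).rowContent i = μ.rowContent i + 1 := by
    simp only [rowContent, rowLen_addBox, ← hi, if_true]
    push_cast
    ring
  have hV := diffProd_mul_prod_erase hoff him
  rw [hon] at hV
  have hF : ∏ j ∈ Finset.range (m + 1), (Nat.factorial ((μ.addBox b).rowLen j + (m - j)) : ℚ) =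
      (μ.rowContent i + 1 + m) *
        ∏ j ∈ Finset.range (m + 1), (Nat.factorial (μ.rowLen j + (m - j)) : ℚ) := by
    rw [← Finset.mul_prod_erase _ _ hmem, ← Finset.mul_prod_erase (Finset.range (m + 1))
      (fun j => (Nat.factorial (μ.rowLen j + (m - j)) : ℚ)) hmem, ← mul_assoc]
    congr 1
    · rw [rowLen_addBox, if_pos hi, add_right_comm, Nat.factorial_succ]
      push_cast [Nat.cast_sub (Nat.lt_succ_iff.1 him), rowContent]
      ring
    · refine Finset.prod_congr rfl fun j hj => ?_
      rw [rowLen_addBox, if_neg (hi ▸ Finset.ne_of_mem_erase hj), add_zero]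
  -- The factor at j = i is 1, and the one at j = m is y_i + 1 + m, which cancels the factor gained
  -- by the factorials.
  have hP : ∏ j ∈ (Finset.range (m + 1)).erase i, (μ.rowContent i + 1 - μ.rowContent j) =
      (∏ j ∈ Finset.range m, (μ.rowContent i + 1 - μ.rowContent j)) *
        (μ.rowContent i + 1 + m) := by
    have := Finset.mul_prod_erase _ (fun j => μ.rowContent i + 1 - μ.rowContent j) hmem
    rw [Finset.prod_range_succ, μ.rowContent_eq_neg hm, sub_neg_eq_add, add_sub_cancel_left, one_mul] at this
    exact this
  have hFne : ∏ j ∈ Finset.range (m + 1), (Nat.factorial (μ.rowLen j + (m - j)) : ℚ) ≠ 0 :=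
    Finset.prod_ne_zero_iff.2 fun j _ => by exact_mod_cast Nat.factorial_ne_zero _
  have hDne : ∏ j ∈ (Finset.range (m + 1)).erase i, (μ.rowContent i - μ.rowContent j) ≠ 0 :=
    Finset.prod_ne_zero_iff.2 fun j hj =>
      sub_ne_zero.2 (μ.rowContent_strictAnti.injective.ne (Finset.ne_of_mem_erase hj).symm)
  have hFne' : ∏ j ∈ Finset.range (m + 1),
      (Nat.factorial ((μ.addBox b).rowLen j + (m - j)) : ℚ) ≠ 0 :=
    Finset.prod_ne_zero_iff.2 fun j _ => by exact_mod_cast Nat.factorial_ne_zero _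
  rw [hF] at hH' hFne'
  have hcne := left_ne_zero_of_mul hFne'
  have hVne := right_ne_zero_of_mul (hH.trans_ne hFne)
  rw [transitionWeight, div_eq_div_iff (prod_hookLength_ne_zero _) hDne]
  rw [hP] at hV
  rw [← hH] at hH'
  refine mul_right_cancel₀ (mul_ne_zero hVne hcne) ?_
  linear_combination (-(∏ j ∈ (Finset.range (m + 1)).erase i,
    (μ.rowContent i - μ.rowContent j))) * hH' +
    (∏ x ∈ (μ.addBox b).cells, ((μ.addBox b).hookLength x : ℚ)) * hV

/-- Row i is then as long as row i - 1, so y_i + 1 = y_{i-1} and the numerator has a zero factor. -/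
theorem transitionWeight_eq_zero {μ : YoungDiagram} {m i : ℕ} (hi : i < m + 1)
    (h : ¬ μ.IsAddable (i, μ.rowLen i)) : transitionWeight m μ.rowContent i = 0 := by
  have h' := mt isAddable_of_rowLen_lt h
  push Not at h'
  obtain ⟨k, rfl⟩ := Nat.exists_eq_succ_of_ne_zero h'.1
  have hk : μ.rowLen (k + 1) = μ.rowLen k := le_antisymm (μ.rowLen_anti _ _ k.le_succ) h'.2
  rw [transitionWeight, Finset.prod_eq_zero (Finset.mem_range.2 (Nat.succ_lt_succ_iff.1 hi)),
    zero_div]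
  simp only [rowContent, Nat.succ_eq_add_one, hk]
  push_cast
  ring

theorem IsAddable.boxContent_eq {μ : YoungDiagram} {b : ℕ × ℕ} (hb : μ.IsAddable b) :
    (boxContent b : ℚ) = μ.rowContent b.1 := by
  simp [boxContent, rowContent, hb.snd_eq]

theorem sum_addableBox_eq (μ : YoungDiagram) (k : ℕ) {m : ℕ} (hm : μ.colLen 0 ≤ m) :
    ∑ b : μ.AddableBox, (boxContent b.1 : ℚ) ^ k *
      ((∏ x ∈ μ.cells, (μ.hookLength x : ℚ)) /
        ∏ x ∈ (μ.addBox b).cells, ((μ.addBox b).hookLength x : ℚ)) =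
      ∑ i ∈ Finset.range (m + 1), μ.rowContent i ^ k * transitionWeight m μ.rowContent i := by
  refine Finset.sum_of_injOn (fun b => b.1.1) ?_ ?_ ?_ ?_
  · intro b _ c _ hbc
    refine Subtype.ext (Prod.ext hbc ?_)
    rw [b.2.snd_eq, c.2.snd_eq]
    exact congrArg _ hbc
  · intro b _
    exact Finset.mem_coe.2 (Finset.mem_range.2 (Nat.lt_succ_of_le (b.2.fst_le.trans hm)))
  · intro i hi hni
    rw [transitionWeight_eq_zero (Finset.mem_range.1 hi), mul_zero]
    exact fun h => hni ⟨⟨_, h⟩, by simp, rfl⟩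
  · intro b _
    rw [μ.hookLength_ratio_eq_transitionWeight b hm, b.2.boxContent_eq]

theorem card_eq_sum_rowLen (μ : YoungDiagram) {m : ℕ} (hm : μ.colLen 0 ≤ m) :
    μ.card = ∑ i ∈ Finset.range m, μ.rowLen i := by
  rw [YoungDiagram.card, Finset.card_eq_sum_ones,
    Finset.sum_finset_product _ _ (fun i => Finset.range (μ.rowLen i))
      (μ.mem_cells_iff_of_colLen_le hm)]
  simp

end YoungDiagram

theorem mainTheorem2 (n : ℕ) (μ : YoungDiagram) (hμ : μ.card = n) :
    (∑ b : μ.AddableBox, (YoungDiagram.boxContent b.1 : ℚ) *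
        ((∏ x ∈ μ.cells, (μ.hookLength x : ℚ)) /
          ∏ x ∈ (μ.addBox b).cells, ((μ.addBox b).hookLength x : ℚ)) = 0) ∧
    (∑ b : μ.AddableBox, (YoungDiagram.boxContent b.1 : ℚ) ^ 2 *
        ((∏ x ∈ μ.cells, (μ.hookLength x : ℚ)) /
          ∏ x ∈ (μ.addBox b).cells, ((μ.addBox b).hookLength x : ℚ)) = (n : ℚ)) := by
  have hinj := μ.rowContent_strictAnti.injective.injOn (s := Finset.range (μ.colLen 0 + 1))
  constructor
  · have h := μ.sum_addableBox_eq 1 le_rfl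
    simp only [pow_one] at h
    rw [h, sum_mul_transitionWeight hinj (μ.rowContent_eq_neg le_rfl)]
  · rw [μ.sum_addableBox_eq 2 le_rfl, sum_sq_mul_transitionWeight hinj (μ.rowContent_eq_neg le_rfl),
      ← hμ, μ.card_eq_sum_rowLen le_rfl]
    simp [YoungDiagram.rowContent]
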